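/- Consider a finite game with a finite set $N$ of agents, a finite nonempty set $S_i$ of pure strategies for each $i\in N$, and utility functions $u_i:\prod_{j} S_j\to\mathbb{R}$. Let $\Delta_i=\{t\in\mathbb{R}^{S_i}: t_\alpha\ge 0,\ \sum_\alpha t_\alpha=1\}$ and $\Delta=\prod_i\Delta_i$, write $e_{i\alpha}$ for the standard unit vectors of $\mathbb{R}^{S_i}$ and $(t,x_{-i})$ for $x$ with its $i$-th component replaced by $t$, and extend $u_i$ multilinearly to $\prod_j\mathbb{R}^{S_j}$ by $u_i(x)=\sum_{k\in\prod_j S_j}u_i(k)\prod_j x_{jk_j}$. A profile $\hat x\in\Delta$ is a *Nash equilibrium* if $u_i(\hat x)=\max_{t\in\Delta_i}u_i(t,\hat x_{-i})$ for all $i$. A function $\varphi:\prod_i\mathbb{R}^{S_i}\to\prod_i\mathbb{R}^{S_i}$ is an *incentive function* if for all $i$ and $x$ one has $\varphi_{i\alpha}(x)\ge 0$ whenever $x_{i\alpha}=0$, and $\sum_\beta\varphi_{i\beta}(x)\ne-1$. A profile $\hat x\in\Delta$ is an *incentive equilibrium* for $\varphi$ if $$\hat x_i\cdot\frac{\varphi_i(\hat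 x)}{\hat x_i}=\max_{t\in\Delta_i}\ t\cdot\frac{\varphi_i(\hat x)}{\hat x_i}\qquad\text{for all } i,$$ where $\varphi_i(\hat x)/\hat x_i$ is the vector of the quotients $\varphi_{i\alpha}(\hat x)/\hat x_{i\alpha}$, with values in $[-\infty,\infty]$; a quotient with numerator $0$ is $0$, a nonzero numerator over $0$ gives $\pm\infty$ with the sign of the numerator, and $0\cdot(\pm\infty)=0$. Let $\varphi^{Nash}_{i\alpha}(x)=(u_i(e_{i\alpha},x_{-i})-u_i(x))_+$, where $(y)_+=\max(0,y)$. Then $\varphi^{Nash}$ is a continuous incentive function, its incentive equilibria are exactly the Nash equilibria of the game, and the game has a Nash equilibrium. (In particular, an incentive equilibrium for $\varphi^{Nash}$ exists.) -/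

import Mathlib

noncomputable section

namespace IncentiveGame

/-! A finite game has a finite set `N` of agents, finite sets `S i` of pure strategies and utility
functions `u i : (Π j, S j) → ℝ`.  Points of `Π i, ℝ^(S i)` are functions `x : ∀ i, S i → ℝ`, and
`(t, x_{-i})` is `Function.update x i t`. -/

/-- The mixed strategy space `Δ = Π i, Δ_i`, with `Δ_i` the simplex on the pure strategies
of agent `i`. Its elements are the strategy profiles. -/
def mixedProfiles {N : Type*} (S : N → Type*) [∀ i, Fintype (S i)] : Set (∀ i, S i → ℝ) :=
  {x | ∀ i, x i ∈ stdSimplex ℝ (S i)}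

/-- The multilinear extension to `Π j, ℝ^(S j)` of a real function `v` of pure profiles:
the sum over all pure profiles `k` of `v k * Π j, x_{j, k_j}`. -/
def extend {N : Type*} [Fintype N] [DecidableEq N] {S : N → Type*} [∀ i, Fintype (S i)]
    (v : (∀ j, S j) → ℝ) (x : ∀ j, S j → ℝ) : ℝ :=
  ∑ k : ∀ j, S j, v k * ∏ j, x j (k j)

/-- The standard unit vector `e_{iα}`. -/
def unitVec {A : Type*} [DecidableEq A] (a : A) : A → ℝ := Pi.single a 1

/-- `x ∈ Δ` is a Nash equilibrium: `u_i(x)` is the maximum of `u_i(t, x_{-i})` over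
`t ∈ Δ_i`, for all `i`. -/
def IsNashEquilibrium {N : Type*} [Fintype N] [DecidableEq N] {S : N → Type*}
    [∀ i, Fintype (S i)] (u : N → (∀ j, S j) → ℝ) (x : ∀ j, S j → ℝ) : Prop :=
  x ∈ mixedProfiles S ∧ ∀ i, IsGreatest
    ((fun t : S i → ℝ => extend (u i) (Function.update x i t)) '' stdSimplex ℝ (S i))
    (extend (u i) x)

/-- `φ` is an incentive function: `x_{iα} = 0` implies `0 ≤ φ_{iα}(x)`, and
`∑ β, φ_{iβ}(x) ≠ -1` for all `x`. -/
def IsIncentive {N : Type*} {S : N → Type*} [∀ i, Fintype (S i)]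
    (φ : (∀ i, S i → ℝ) → (∀ i, S i → ℝ)) : Prop :=
  ∀ i, (∀ x a, x i a = 0 → 0 ≤ φ x i a) ∧ (∀ x, ∑ b, φ x i b ≠ -1)

/-- The quotient `p / y` with the convention that it is `0` if `p = 0` (even if `y = 0`);
for `p ≠ 0` and `y = 0` it is infinite, with the sign of `p`. -/
def quotient (p y : ℝ) : EReal :=
  if p = 0 then 0
  else if y = 0 then (if 0 < p then ⊤ else ⊥)
  else ((p / y : ℝ) : EReal)

/-- The dot product `t · (p / y)`, where `p / y` is the vector of the quotients `p_α / y_α`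
and `0 * ∞ = 0`. -/
def dotQuotient {A : Type*} [Fintype A] (t p y : A → ℝ) : EReal :=
  ∑ a, (t a : EReal) * quotient (p a) (y a)

/-- `x ∈ Δ` is an incentive equilibrium: `x_i · (φ_i(x) / x_i)` is the maximum of
`t · (φ_i(x) / x_i)` over `t ∈ Δ_i`, for all `i`. -/
def IsIncentiveEquilibrium {N : Type*} {S : N → Type*} [∀ i, Fintype (S i)]
    (φ : (∀ i, S i → ℝ) → (∀ i, S i → ℝ)) (x : ∀ i, S i → ℝ) : Prop :=
  x ∈ mixedProfiles S ∧ ∀ i, IsGreatest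
    ((fun t : S i → ℝ => dotQuotient t (φ x i) (x i)) '' stdSimplex ℝ (S i))
    (dotQuotient (x i) (φ x i) (x i))

/-- The Nash incentive `φ_{iα}(x) = (u_i(e_{iα}, x_{-i}) - u_i(x))_+`. -/
def nashIncentive {N : Type*} [Fintype N] [DecidableEq N] {S : N → Type*}
    [∀ i, Fintype (S i)] [∀ i, DecidableEq (S i)] (u : N → (∀ j, S j) → ℝ)
    (x : ∀ i, S i → ℝ) : ∀ i, S i → ℝ :=
  fun i a => max 0 (extend (u i) (Function.update x i (unitVec a)) - extend (u i) x)

end IncentiveGame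

end

/-!
The work lies in the existence of a Nash equilibrium, for which no fixed point theorem is needed:
it follows from a covering theorem for the standard simplex, and that from a parity argument.

Scarf's lemma (`exists_dominant_colorful`) concerns a finite set `X` with one ranking for each
`i : I`, whose points are coloured by `I`. A set is dominant if no point of `X` beats its minimum in
all rankings. One counts the pairs of a dominant set with `|I|` elements and a subset of it with
`|I| - 1` elements that carries all colours but `i₀`. A dominant set not carrying all colours has an
even number of such subsets (`even_card_subsets_almost_colorful`), and such a subset lies in exactly
two dominant sets with `|I|` elements (`card_dominant_superset_eq_two`), except for one that lies in
exactly one (`card_dominant_superset_special_eq_one`). Hence some dominant set carries all colours.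

For grid points of the simplex, ranked by their coordinates, dominant sets are small in diameter,
and a limit gives a theorem of Knaster–Kuratowski–Mazurkiewicz type
(`exists_mem_stdSimplex_of_closed_cover`): if closed sets `A i` cover the simplex, some point `x`
has `x i = 0` or `x ∈ A i` for every `i`. Applied to the simplex on all pairs of an agent and a pure
strategy, with sets expressing that the strategy is a best reply and that the agent has not more
than the average weight, it yields a Nash equilibrium (`exists_isNashEquilibrium`).

Nash equilibria are the profiles at which all Nash incentives vanish. At an incentive equilibrium,
the incentives `φ` of an agent satisfy `φ a ≤ x a * ∑ b, φ b`; as some strategy in the support does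
not beat the average and so has incentive `0`, summing over the others gives `∑ b, φ b = 0`
(`isIncentiveEquilibrium_nashIncentive_iff`).
-/

namespace IncentiveGame

/-! ### Scarf's lemma -/

/-- For a family `r` of rankings of `X`, a set `B` is dominant if no point of `X` lies strictly
above the minimum of `B` in all rankings at once. -/
def Dominant {X I : Type*} (r : I → X → ℤ) (B : Finset X) : Prop :=
  ∀ y, ∃ i, ∀ b ∈ B, r i y ≤ r i b

theorem Dominant.subset {X I : Type*} {r : I → X → ℤ} {τ B : Finset X} (hB : Dominant r B)
    (h : τ ⊆ B) : Dominant r τ := fun y => (hB y).imp fun _ hi b hb => hi b (h hb)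

/-- A dominant set with `|I| - 1` elements, one of which lies below `ι i` in every ranking
`k ≠ i`, is contained in exactly two dominant sets with `|I|` elements: two indices `a`, `b` share
their minimum in `τ`, and the point to be added is, for `k = a` or `k = b`, the `k`-highest of the
points that beat `τ` in all rankings but the `k`-th. -/
theorem card_dominant_superset_eq_two {X I : Type*} [Fintype X] [DecidableEq X] [Fintype I]
    [DecidableEq I] {r : I → X → ℤ} (hr : ∀ i, Function.Injective (r i)) {ι : I → X}
    {τ : Finset X} (hτ : Dominant r τ) (hcard : τ.card + 1 = Fintype.card I)
    {t : X} (ht : t ∈ τ) (htι : ∀ i k, k ≠ i → r k t < r k (ι i))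
    [DecidablePred (Dominant r)] :
    (Finset.univ.filter fun B : Finset X =>
      (Dominant r B ∧ B.card = Fintype.card I) ∧ τ ⊆ B).card = 2 := by
  have hmin : ∀ i, ∃ x ∈ τ, ∀ b ∈ τ, r i x ≤ r i b := fun i =>
    Finset.exists_min_image τ (r i) ⟨t, ht⟩
  choose m hmτ hm using hmin
  have huniq : ∀ i x, x ∈ τ → (∀ b ∈ τ, r i x ≤ r i b) → m i = x := fun i x hx h =>
    hr i (le_antisymm (hm i x hx) (h _ (hmτ i)))
  -- deleting an index that is not needed for surjectivity of `m` makes `m` injective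
  have hinj : ∀ k, (∀ x ∈ τ, ∃ k', k' ≠ k ∧ m k' = x) →
      ∀ i j, i ≠ k → j ≠ k → m i = m j → i = j := by
    intro k hk i j hi hj hij
    have := Finset.injOn_of_surjOn_of_card_le (s := Finset.univ.erase k) (t := τ) m
      (fun i _ => hmτ i) (by
        intro x hx
        obtain ⟨k', h1, h2⟩ := hk x hx
        exact ⟨k', by simpa using h1, h2⟩) (by
        rw [Finset.card_erase_of_mem (Finset.mem_univ k), Finset.card_univ]; omega)
    exact this (by simpa using hi) (by simpa using hj) hij
  obtain ⟨a, -, b, -, hab, hmab⟩ := Finset.exists_ne_map_eq_of_card_lt_of_maps_to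
    (s := Finset.univ) (t := τ) (by rw [Finset.card_univ]; omega) (fun i _ => hmτ i)
  have hsurj : ∀ k, k = a ∨ k = b → ∀ x ∈ τ, ∃ k', k' ≠ k ∧ m k' = x := by
    intro k hk x hx
    obtain ⟨i, hi⟩ := hτ x
    have hix := huniq i x hx hi
    by_cases hik : i = k
    · subst hik
      rcases hk with rfl | rfl
      · exact ⟨b, hab.symm, hmab ▸ hix⟩
      · exact ⟨a, hab, hmab ▸ hix⟩
    · exact ⟨i, hik, hix⟩
  -- the points that beat `τ` in all rankings except possibly the `k`-th
  set M : I → Finset X := fun k => Finset.univ.filter fun y => ∀ k', k' ≠ k → r k' (m k') < r k' y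
    with hM
  have hmem : ∀ k y, y ∈ M k ↔ ∀ k', k' ≠ k → r k' (m k') < r k' y := by simp [hM]
  have hmax : ∀ k, ∃ y ∈ M k, ∀ z ∈ M k, r k z ≤ r k y := fun k =>
    Finset.exists_max_image (M k) (r k)
      ⟨ι k, (hmem _ _).2 fun k' hk' => (hm k' t ht).trans_lt (htι k k' hk')⟩
  choose p hpM hp using hmax
  have hpτ : ∀ k, k = a ∨ k = b → p k ∉ τ := by
    intro k hk hpk
    obtain ⟨k', h1, h2⟩ := hsurj k hk _ hpk
    have := (hmem _ _).1 (hpM k) k' h1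
    rw [h2] at this
    exact lt_irrefl _ this
  have hpab : p a ≠ p b := by
    intro h
    obtain ⟨i, hi⟩ := hτ (p a)
    have h1 := hi _ (hmτ i)
    by_cases hia : i = a
    · have := (hmem _ _).1 (hpM b) i (hia ▸ hab)
      rw [← h] at this; omega
    · have := (hmem _ _).1 (hpM a) i hia
      omega
  have hdom : ∀ k, k = a ∨ k = b → Dominant r (insert (p k) τ) := by
    intro k hk z
    by_contra! hz
    have hzM : z ∈ M k := by
      refine (hmem _ _).2 fun k' hk' => ?_
      obtain ⟨x, hx, hxz⟩ := hz k'
      rcases Finset.mem_insert.1 hx with rfl | hx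
      · exact ((hmem _ _).1 (hpM k) k' hk').trans hxz
      · exact (hm k' x hx).trans_lt hxz
    obtain ⟨i, hi⟩ := hτ z
    have hik : i = k := by
      by_contra hik
      have := (hmem _ _).1 hzM i hik
      have := hi _ (hmτ i)
      omega
    subst hik
    obtain ⟨x, hx, hxz⟩ := hz i
    rcases Finset.mem_insert.1 hx with rfl | hx
    · have := hp i z hzM
      omega
    · have := hi x hx
      omega
  have hset : (Finset.univ.filter fun B : Finset X =>
      (Dominant r B ∧ B.card = Fintype.card I) ∧ τ ⊆ B) = {insert (p a) τ, insert (p b) τ} := by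
    ext B
    simp only [Finset.mem_filter, Finset.mem_univ, true_and, Finset.mem_insert,
      Finset.mem_singleton]
    constructor
    · rintro ⟨⟨hB, hBc⟩, hτB⟩
      obtain ⟨y, hy, rfl⟩ := Finset.exists_eq_insert_iff.2 ⟨hτB, by omega⟩
      obtain ⟨k, hk⟩ := hB y
      -- every other point of the large set attains its minimum for an index other than `k`
      have hother : ∀ x ∈ τ, ∃ k', k' ≠ k ∧ m k' = x ∧ r k' x ≤ r k' y := by
        intro x hx
        obtain ⟨k', hk'⟩ := hB x
        refine ⟨k', ?_, huniq k' x hx fun b hb => hk' b (Finset.mem_insert_of_mem hb),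
          hk' y (Finset.mem_insert_self _ _)⟩
        rintro rfl
        have := hr k' (le_antisymm (hk x (Finset.mem_insert_of_mem hx))
          (hk' y (Finset.mem_insert_self _ _)))
        exact hy (this ▸ hx)
      have hinjk := hinj k fun x hx => by
        obtain ⟨k', h1, h2, -⟩ := hother x hx
        exact ⟨k', h1, h2⟩
      have hkab : k = a ∨ k = b := by
        by_contra! h
        exact hab (hinjk a b h.1.symm h.2.symm hmab)
      have hyM : y ∈ M k := by
        refine (hmem _ _).2 fun k' hk' => ?_
        obtain ⟨k'', h1, h2, h3⟩ := hother _ (hmτ k')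
        obtain rfl := hinjk _ _ h1 hk' h2
        exact lt_of_le_of_ne h3 fun h => hy (hr _ h ▸ hmτ k'')
      have hyp : y = p k := by
        refine hr k (le_antisymm (hp k y hyM) ?_)
        obtain ⟨i, hi⟩ := hB (p k)
        by_cases hik : i = k
        · subst hik
          exact hi y (Finset.mem_insert_self _ _)
        · have := (hmem _ _).1 (hpM k) i hik
          have := hi _ (Finset.mem_insert_of_mem (hmτ i))
          omega
      rcases hkab with rfl | rfl
      · exact Or.inl (by rw [hyp])
      · exact Or.inr (by rw [hyp])
    · rintro (rfl | rfl)
      · exact ⟨⟨hdom a (.inl rfl), by rw [Finset.card_insert_of_notMem (hpτ a (.inl rfl)), hcard]⟩,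
          Finset.subset_insert _ _⟩
      · exact ⟨⟨hdom b (.inr rfl), by rw [Finset.card_insert_of_notMem (hpτ b (.inr rfl)), hcard]⟩,
          Finset.subset_insert _ _⟩
  rw [hset, Finset.card_pair]
  intro h
  have : p a ∈ insert (p b) τ := h ▸ Finset.mem_insert_self _ _
  rcases Finset.mem_insert.1 this with h | h
  · exact hpab h
  · exact hpτ a (.inl rfl) h

/-- The boundary case of `card_dominant_superset_eq_two`: the dominant set consisting of all
special points but one can be completed in only one way, by the highest ordinary point in the
missing ranking. -/
theorem card_dominant_superset_special_eq_one {X I : Type*} [Fintype X] [DecidableEq X]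
    [Fintype I] [DecidableEq I] {r : I → X → ℤ} (hr : ∀ i, Function.Injective (r i)) {ι : I → X}
    (hι : Function.Injective ι) (hlow : ∀ i x, r i (ι i) ≤ r i x)
    (hhigh : ∀ x, x ∉ Set.range ι → ∀ i k, k ≠ i → r k x < r k (ι i))
    (hne : ∃ x, x ∉ Set.range ι) (i₀ : I) [DecidablePred (Dominant r)] :
    (Finset.univ.filter fun B : Finset X => (Dominant r B ∧ B.card = Fintype.card I) ∧
      (Finset.univ.erase i₀).image ι ⊆ B).card = 1 := by
  classical
  set τ := (Finset.univ.erase i₀).image ι with hτ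
  have hτcard : τ.card + 1 = Fintype.card I := by
    rw [hτ, Finset.card_image_of_injective _ hι, Finset.card_erase_of_mem (Finset.mem_univ _),
      Finset.card_univ]
    have : 0 < Fintype.card I := Fintype.card_pos_iff.2 ⟨i₀⟩
    omega
  have hτmem : ∀ j, j ≠ i₀ → ι j ∈ τ := fun j hj =>
    Finset.mem_image_of_mem ι (by simpa using hj)
  obtain ⟨x₀, hx₀⟩ := hne
  obtain ⟨p, hp, hpmax⟩ := Finset.exists_max_image
    (Finset.univ.filter fun x => x ∉ Set.range ι) (r i₀) ⟨x₀, by simpa using hx₀⟩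
  simp only [Finset.mem_filter, Finset.mem_univ, true_and] at hp hpmax
  have hpτ : p ∉ τ := by
    intro h
    obtain ⟨j, -, rfl⟩ := Finset.mem_image.1 h
    exact hp ⟨j, rfl⟩
  rw [Finset.card_eq_one]
  refine ⟨insert p τ, ?_⟩
  ext B
  simp only [Finset.mem_filter, Finset.mem_univ, true_and, Finset.mem_singleton]
  constructor
  · rintro ⟨⟨hB, hBc⟩, hτB⟩
    obtain ⟨y, hy, rfl⟩ := Finset.exists_eq_insert_iff.2 ⟨hτB, by omega⟩
    -- an ordinary point can only be bounded in the ranking `i₀`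
    have key : ∀ z, z ∉ Set.range ι → r i₀ z ≤ r i₀ y := by
      intro z hz
      obtain ⟨i, hi⟩ := hB z
      by_cases hii : i = i₀
      · exact hii ▸ hi y (Finset.mem_insert_self _ _)
      · exact absurd ⟨i, hr i (le_antisymm (hlow i z)
          (hi _ (Finset.mem_insert_of_mem (hτmem i hii))))⟩ hz
    have hyr : y ∉ Set.range ι := by
      rintro ⟨j, rfl⟩
      by_cases hj : j = i₀
      · subst hj
        exact hx₀ ⟨j, hr j (le_antisymm (hlow j x₀) (key x₀ hx₀))⟩
      · exact hy (hτmem j hj)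
    rw [hr i₀ (le_antisymm (hpmax y hyr) (key p hp))]
  · rintro rfl
    refine ⟨⟨fun z => ?_, by rw [Finset.card_insert_of_notMem hpτ, hτcard]⟩,
      Finset.subset_insert _ _⟩
    by_cases hz : z ∈ Set.range ι
    · obtain ⟨k, rfl⟩ := hz
      exact ⟨k, fun b _ => hlow k b⟩
    · refine ⟨i₀, fun b hb => ?_⟩
      rcases Finset.mem_insert.1 hb with rfl | hb
      · exact hpmax z hz
      · obtain ⟨j, hj, rfl⟩ := Finset.mem_image.1 hb
        exact (hhigh z hz j i₀ (by simpa using (Finset.mem_erase.1 hj).1.symm)).le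

/-- A set with `|I|` elements whose colours are not all of `I` has an even number (none or two) of
subsets with `|I| - 1` elements that carry all colours but `i₀`. -/
theorem even_card_subsets_almost_colorful {X I : Type*} [Fintype X] [DecidableEq X] [Fintype I]
    [DecidableEq I] (c : X → I) (i₀ : I) {B : Finset X} (hB : B.card = Fintype.card I)
    (hBc : B.image c ≠ Finset.univ) :
    Even (Finset.univ.filter fun τ : Finset X =>
      (τ.card + 1 = Fintype.card I ∧ τ.image c = Finset.univ.erase i₀) ∧ τ ⊆ B).card := by
  classical
  rcases Finset.eq_empty_or_nonempty (Finset.univ.filter fun τ : Finset X =>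
      (τ.card + 1 = Fintype.card I ∧ τ.image c = Finset.univ.erase i₀) ∧ τ ⊆ B) with h | ⟨τ, h⟩
  · simp [h]
  simp only [Finset.mem_filter, Finset.mem_univ, true_and] at h
  obtain ⟨⟨hτ, hτc⟩, hτB⟩ := h
  have hinj : ∀ τ : Finset X, τ.card + 1 = Fintype.card I →
      τ.image c = Finset.univ.erase i₀ → Set.InjOn c τ := by
    intro τ h1 h2
    refine Finset.card_image_iff.1 ?_
    rw [h2, Finset.card_erase_of_mem (Finset.mem_univ _), Finset.card_univ]
    omega
  obtain ⟨y, hy, rfl⟩ := Finset.exists_eq_insert_iff.2 ⟨hτB, by omega⟩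
  have hcy : c y ∈ τ.image c := by
    rw [hτc, Finset.mem_erase]
    refine ⟨fun h => hBc ?_, Finset.mem_univ _⟩
    rw [Finset.image_insert, hτc, h, Finset.insert_erase (Finset.mem_univ _)]
  obtain ⟨x, hx, hxy⟩ := Finset.mem_image.1 hcy
  have hne : x ≠ y := fun h => hy (h ▸ hx)
  have hset : (Finset.univ.filter fun σ : Finset X =>
      (σ.card + 1 = Fintype.card I ∧ σ.image c = Finset.univ.erase i₀) ∧ σ ⊆ insert y τ)
      = {τ, insert y (τ.erase x)} := by
    ext σ
    simp only [Finset.mem_filter, Finset.mem_univ, true_and, Finset.mem_insert,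
      Finset.mem_singleton]
    constructor
    · rintro ⟨⟨h1, h2⟩, h3⟩
      obtain ⟨w, hw, hwB⟩ := Finset.exists_eq_insert_iff.2 ⟨h3, by omega⟩
      have hσ : σ = (insert y τ).erase w := by rw [← hwB, Finset.erase_insert hw]
      have hmem : ∀ z ∈ insert y τ, z ≠ w → z ∈ σ := fun z hz hzw => by
        rw [hσ]; exact Finset.mem_erase.2 ⟨hzw, hz⟩
      by_cases hwy : w = y
      · left; rw [hσ, hwy, Finset.erase_insert hy]
      by_cases hwx : w = x
      · right; rw [hσ, hwx, Finset.erase_insert_of_ne hne.symm]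
      exact absurd (hinj σ h1 h2 (hmem x (Finset.mem_insert_of_mem hx) (Ne.symm hwx))
        (hmem y (Finset.mem_insert_self _ _) (Ne.symm hwy)) hxy) hne
    · rintro (rfl | rfl)
      · exact ⟨⟨hτ, hτc⟩, hτB⟩
      · refine ⟨⟨?_, ?_⟩, Finset.insert_subset_insert _ (Finset.erase_subset _ _)⟩
        · rw [Finset.card_insert_of_notMem (fun h => hy (Finset.mem_of_mem_erase h)),
            Finset.card_erase_of_mem hx]
          have := Finset.card_pos.2 ⟨x, hx⟩
          omega
        · rw [Finset.image_insert, ← hxy, ← Finset.image_insert, Finset.insert_erase hx, hτc]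
  rw [hset, Finset.card_pair]
  · exact even_two
  · intro h
    exact hy (h ▸ Finset.mem_insert_self _ _)

/-- **Scarf's lemma**, in combinatorial form. Let `ι i` be special points of colour `i`, lowest in
the ranking `i` and above all ordinary points in the other rankings. Then some dominant set carries
every colour. -/
theorem exists_dominant_colorful {X I : Type*} [Fintype X] [DecidableEq X]
    [Fintype I] [DecidableEq I] [Nonempty I] {r : I → X → ℤ} (hr : ∀ i, Function.Injective (r i))
    {ι : I → X} (hι : Function.Injective ι) (hlow : ∀ i x, r i (ι i) ≤ r i x)
    (hhigh : ∀ x, x ∉ Set.range ι → ∀ i k, k ≠ i → r k x < r k (ι i))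
    (hne : ∃ x, x ∉ Set.range ι) (c : X → I) (hc : ∀ i, c (ι i) = i) :
    ∃ B : Finset X, Dominant r B ∧ B.image c = Finset.univ := by
  classical
  by_contra! hno
  obtain ⟨i₀⟩ := ‹Nonempty I›
  set R := Finset.univ.filter fun B : Finset X => Dominant r B ∧ B.card = Fintype.card I with hR
  set D := Finset.univ.filter fun τ : Finset X =>
    Dominant r τ ∧ τ.card + 1 = Fintype.card I ∧ τ.image c = Finset.univ.erase i₀ with hD
  set τ₀ := (Finset.univ.erase i₀).image ι with hτ₀
  have hcount := Finset.sum_card_bipartiteAbove_eq_sum_card_bipartiteBelow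
    (s := D) (t := R) (fun τ B => τ ⊆ B)
  have hroom : Even (∑ B ∈ R, (D.bipartiteBelow (fun τ B => τ ⊆ B) B).card) := by
    refine Finset.even_sum _ fun B hB => ?_
    simp only [hR, Finset.mem_filter, Finset.mem_univ, true_and] at hB
    have hset : D.bipartiteBelow (fun τ B => τ ⊆ B) B = Finset.univ.filter fun τ : Finset X =>
        (τ.card + 1 = Fintype.card I ∧ τ.image c = Finset.univ.erase i₀) ∧ τ ⊆ B := by
      ext τ
      simp only [Finset.bipartiteBelow, hD, Finset.mem_filter, Finset.mem_univ, true_and]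
      exact ⟨fun h => ⟨h.1.2, h.2⟩, fun h => ⟨⟨hB.1.subset h.2, h.1⟩, h.2⟩⟩
    rw [hset]
    exact even_card_subsets_almost_colorful c i₀ hB.2 (hno B hB.1)
  have hcongr : ∀ τ, (R.bipartiteAbove (fun τ B => τ ⊆ B) τ) = Finset.univ.filter
      fun B : Finset X => (Dominant r B ∧ B.card = Fintype.card I) ∧ τ ⊆ B := by
    intro τ
    ext B
    simp [Finset.bipartiteAbove, hR]
  have hτ₀D : τ₀ ∈ D := by
    simp only [hD, Finset.mem_filter, Finset.mem_univ, true_and]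
    refine ⟨fun z => ?_, ?_, ?_⟩
    · by_cases hz : z ∈ Set.range ι
      · obtain ⟨k, rfl⟩ := hz
        exact ⟨k, fun b _ => hlow k b⟩
      · refine ⟨i₀, fun b hb => ?_⟩
        obtain ⟨j, hj, rfl⟩ := Finset.mem_image.1 hb
        exact (hhigh z hz j i₀ (Finset.mem_erase.1 hj).1.symm).le
    · rw [hτ₀, Finset.card_image_of_injective _ hι, Finset.card_erase_of_mem (Finset.mem_univ _),
        Finset.card_univ]
      have : 0 < Fintype.card I := Fintype.card_pos_iff.2 ⟨i₀⟩
      omega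
    · rw [hτ₀, Finset.image_image]
      rw [show c ∘ ι = id from funext hc, Finset.image_id]
  have hdoor : ∀ τ ∈ D.erase τ₀, Even (R.bipartiteAbove (fun τ B => τ ⊆ B) τ).card := by
    intro τ hτ
    simp only [hD, Finset.mem_erase, Finset.mem_filter, Finset.mem_univ, true_and] at hτ
    obtain ⟨hne', hdom, hcard, himg⟩ := hτ
    -- a set of special points with the colours of `τ₀` is `τ₀` itself
    obtain ⟨t, ht, htι⟩ : ∃ t ∈ τ, t ∉ Set.range ι := by
      by_contra! hall
      refine hne' ?_
      rw [hτ₀, ← himg, Finset.image_image]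
      ext x
      simp only [Finset.mem_image, Function.comp_apply]
      constructor
      · intro hx
        obtain ⟨i, rfl⟩ := hall x hx
        exact ⟨_, hx, by rw [hc]⟩
      · rintro ⟨y, hy, rfl⟩
        obtain ⟨i, rfl⟩ := hall y hy
        rwa [hc]
    rw [hcongr, card_dominant_superset_eq_two hr hdom hcard ht (hhigh t htι)]
    exact even_two
  have hone : (R.bipartiteAbove (fun τ B => τ ⊆ B) τ₀).card = 1 := by
    rw [hcongr]
    exact card_dominant_superset_special_eq_one hr hι hlow hhigh hne i₀
  rw [← hcount, ← Finset.add_sum_erase _ _ hτ₀D, hone] at hroom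
  have := Finset.even_sum _ hdoor
  rw [Nat.even_add] at hroom
  exact absurd (hroom.2 this) (by decide)

/-! ### Closed covers of the simplex -/

/-- Scarf's lemma for the grid of nonnegative integer vectors with sum `n`, coloured by `I`: some
grid point `x` has, for every colour `i`, a point of colour `i` close to it, unless the coordinate
`x i` is small. The rankings are by the `i`-th coordinate, with ties broken in any fixed way. -/
theorem exists_grid_point_near_colors {I : Type*} [Fintype I] [DecidableEq I] [Nonempty I]
    (n : ℕ) (c : (I → ℕ) → I) :
    ∃ x : I → ℕ, ∑ i, x i = n ∧ ∀ i, x i ≤ Fintype.card I ∨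
      ∃ z : I → ℕ, ∑ j, z j = n ∧ c z = i ∧
        ∀ j, |(z j : ℤ) - (x j : ℤ)| ≤ (Fintype.card I : ℤ) := by
  classical
  let T := {x : I → ℕ // x ∈ Finset.piAntidiag Finset.univ n}
  let _ : Fintype T := Finset.Subtype.fintype _
  have hT : ∀ x : I → ℕ, x ∈ Finset.piAntidiag Finset.univ n ↔ ∑ i, x i = n := by
    intro x; simp [Finset.mem_piAntidiag]
  -- the special point of colour `j` is placed at coordinate `-1` in direction `j`, and beyond the
  -- grid in all other directions
  let val : T ⊕ I → I → ℤ :=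
    Sum.elim (fun x i => (x.1 i : ℤ)) (fun j i => if i = j then -1 else n + 1)
  let e := Fintype.equivFin (T ⊕ I)
  let r : I → T ⊕ I → ℤ := fun i x => val x i * (Fintype.card (T ⊕ I) : ℤ) + ((e x : ℕ) : ℤ)
  have hlt : ∀ i x y, val x i < val y i → r i x < r i y := by
    intro i x y h
    have h1 : ((e x : ℕ) : ℤ) < (Fintype.card (T ⊕ I) : ℤ) := by exact_mod_cast (e x).2
    have h2 : (0 : ℤ) ≤ ((e y : ℕ) : ℤ) := by positivity
    have h3 : (val x i + 1) * (Fintype.card (T ⊕ I) : ℤ) ≤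
        val y i * (Fintype.card (T ⊕ I) : ℤ) :=
      mul_le_mul_of_nonneg_right h (by positivity)
    simp only [r]
    linarith
  have hle : ∀ i x y, r i x ≤ r i y → val x i ≤ val y i := fun i x y h =>
    le_of_not_gt fun h' => (hlt i y x h').not_ge h
  have hr : ∀ i, Function.Injective (r i) := by
    intro i x y h
    have hv : val x i = val y i := le_antisymm (hle i x y h.le) (hle i y x h.ge)
    simp only [r, hv, add_right_inj, Nat.cast_inj] at h
    exact e.injective (Fin.ext h)
  have hval : ∀ (x : T) i, (x.1 i : ℤ) ≤ n := by
    intro x i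
    have := (hT x.1).1 x.2
    have h := Finset.single_le_sum (f := x.1) (fun _ _ => Nat.zero_le _) (Finset.mem_univ i)
    exact_mod_cast this ▸ h
  obtain ⟨i₁⟩ := id ‹Nonempty I›
  obtain ⟨B, hB, hBc⟩ := exists_dominant_colorful hr (ι := Sum.inr) Sum.inr_injective
    (by
      intro i x
      rcases eq_or_ne x (Sum.inr i) with rfl | hx
      · exact le_rfl
      refine (hlt i _ _ ?_).le
      rcases x with x | j
      · simp only [val, Sum.elim_inl, Sum.elim_inr, if_true]; omega
      · have : i ≠ j := fun h => hx (h ▸ rfl)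
        simp only [val, Sum.elim_inr, if_true, if_neg this]; omega)
    (by
      rintro (x | j) hx i k hk
      · refine hlt k _ _ ?_
        have := hval x k
        simp only [val, Sum.elim_inl, Sum.elim_inr, if_neg hk]; omega
      · exact absurd ⟨j, rfl⟩ hx)
    ⟨Sum.inl ⟨Pi.single i₁ n, (hT _).2 (by simp)⟩, by simp⟩
    (Sum.elim (fun x => c x.1) id) (fun i => rfl)
  set C : Finset I := Finset.univ.filter fun i => Sum.inr i ∉ B with hC
  have hmemC : ∀ i, i ∈ C ↔ Sum.inr i ∉ B := by simp [hC]
  have hdom : ∀ t : T, ∃ i ∈ C, ∀ x : T, Sum.inl x ∈ B → t.1 i ≤ x.1 i := by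
    intro t
    obtain ⟨i, hi⟩ := hB (Sum.inl t)
    refine ⟨i, (hmemC i).2 fun h => ?_, fun x hx => ?_⟩
    · have := hle _ _ _ (hi _ h)
      simp only [val, Sum.elim_inl, Sum.elim_inr, if_true] at this
      omega
    · have := hle _ _ _ (hi _ hx)
      simpa [val] using this
  have hcol : ∀ i ∈ C, ∃ x : T, Sum.inl x ∈ B ∧ c x.1 = i := by
    intro i hi
    obtain ⟨b, hb, hbi⟩ := Finset.mem_image.1 (hBc ▸ Finset.mem_univ i)
    rcases b with x | j
    · exact ⟨x, hb, hbi⟩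
    · exact absurd hb ((hmemC _).1 ((show j = i from hbi) ▸ hi))
  obtain ⟨i₀, hi₀, -⟩ := hdom ⟨Pi.single i₁ n, (hT _).2 (by simp)⟩
  obtain ⟨x₀, hx₀, -⟩ := hcol i₀ hi₀
  have hmin : ∀ i, ∃ y : T, Sum.inl y ∈ B ∧ ∀ x : T, Sum.inl x ∈ B → y.1 i ≤ x.1 i := by
    intro i
    obtain ⟨y, hy, hmin⟩ := Finset.exists_min_image
      (Finset.univ.filter fun x : T => Sum.inl x ∈ B) (fun x => x.1 i) ⟨x₀, by simpa using hx₀⟩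
    exact ⟨y, by simpa using hy, fun x hx => hmin x (by simpa using hx)⟩
  choose y hyB hy using hmin
  -- otherwise a grid point would exceed the minimum of `B` in every coordinate of `C`
  have hsum : n < ∑ i ∈ C, ((y i).1 i + 1) := by
    by_contra! h
    obtain ⟨i, hi, hit⟩ := hdom ⟨fun i => (if i ∈ C then (y i).1 i + 1 else 0) +
        (if i = i₀ then n - ∑ i ∈ C, ((y i).1 i + 1) else 0), (hT _).2 (by
      rw [Finset.sum_add_distrib, Finset.sum_ite_mem, Finset.univ_inter,
        Finset.sum_ite_eq' Finset.univ i₀]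
      simp only [Finset.mem_univ, if_true]
      omega)⟩
    have := hit (y i) (hyB i)
    simp only [if_pos hi] at this
    omega
  have hbound : ∀ x : T, Sum.inl x ∈ B → ∀ i,
      x.1 i ≤ (if i ∈ C then (y i).1 i else 0) + Fintype.card I := by
    intro x hx i
    have hge : ∀ j, (if j ∈ C then (y j).1 j else 0) ≤ x.1 j := by
      intro j
      split_ifs
      · exact hy j x hx
      · exact Nat.zero_le _
    have h1 : ∑ j, ((x.1 j - (if j ∈ C then (y j).1 j else 0)) +
        (if j ∈ C then (y j).1 j else 0)) = n := by
      exact (Finset.sum_congr rfl fun j _ => Nat.sub_add_cancel (hge j)).trans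
        ((hT x.1).1 x.2)
    rw [Finset.sum_add_distrib, Finset.sum_ite_mem, Finset.univ_inter] at h1
    rw [Finset.sum_add_distrib, Finset.sum_const, smul_eq_mul, mul_one] at hsum
    have h2 := Finset.single_le_sum
      (f := fun j => x.1 j - (if j ∈ C then (y j).1 j else 0))
      (fun _ _ => Nat.zero_le _) (Finset.mem_univ i)
    have h3 : C.card ≤ Fintype.card I := Finset.card_le_univ C
    omega
  refine ⟨x₀.1, (hT _).1 x₀.2, fun i => ?_⟩
  by_cases hi : i ∈ C
  · obtain ⟨z, hz, hzi⟩ := hcol i hi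
    refine Or.inr ⟨z.1, (hT _).1 z.2, hzi, fun j => ?_⟩
    have h1 := hbound z hz j
    have h2 := hbound x₀ hx₀ j
    have h3 := hy j z hz
    have h4 := hy j x₀ hx₀
    rw [abs_le]
    split_ifs at h1 h2 <;> constructor <;> omega
  · have := hbound x₀ hx₀ i
    rw [if_neg hi] at this
    exact Or.inl (by omega)

/-- A covering theorem of Knaster–Kuratowski–Mazurkiewicz type: if closed sets `A i`, indexed by
the vertices, cover the standard simplex, then some point of it lies in all `A i` with `x i ≠ 0`. -/
theorem exists_mem_stdSimplex_of_closed_cover {I : Type*} [Fintype I] [Nonempty I]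
    {A : I → Set (I → ℝ)} (hA : ∀ i, IsClosed (A i))
    (hcov : ∀ x ∈ stdSimplex ℝ I, ∃ i, x ∈ A i) :
    ∃ x ∈ stdSimplex ℝ I, ∀ i, x i = 0 ∨ x ∈ A i := by
  classical
  have happrox : ∀ n : ℕ, ∃ x ∈ stdSimplex ℝ I, ∀ i, x i ≤ Fintype.card I * (1 / ((n : ℝ) + 1)) ∨
      ∃ z ∈ A i, dist x z ≤ Fintype.card I * (1 / ((n : ℝ) + 1)) := by
    intro n
    have hn : (0 : ℝ) < (n : ℝ) + 1 := by positivity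
    let q : (I → ℕ) → I → ℝ := fun x j => (x j : ℝ) * (1 / ((n : ℝ) + 1))
    have hq : ∀ x : I → ℕ, ∑ j, x j = n + 1 → q x ∈ stdSimplex ℝ I := by
      intro x hx
      refine ⟨fun j => by positivity, ?_⟩
      simp only [q]
      rw [← Finset.sum_mul, ← Nat.cast_sum, hx]
      push_cast
      field_simp
    have hcol : ∀ x : I → ℕ, ∃ i, ∑ j, x j = n + 1 → q x ∈ A i := by
      intro x
      by_cases hx : ∑ j, x j = n + 1
      · exact (hcov _ (hq x hx)).imp fun i hi _ => hi
      · exact ⟨Classical.arbitrary I, fun h => absurd h hx⟩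
    choose c hc using hcol
    obtain ⟨x, hx, hnear⟩ := exists_grid_point_near_colors (n + 1) c
    refine ⟨q x, hq x hx, fun i => ?_⟩
    rcases hnear i with h | ⟨z, hz, hzi, hzx⟩
    · left
      have : (x i : ℝ) ≤ Fintype.card I := by exact_mod_cast h
      exact mul_le_mul_of_nonneg_right this (by positivity)
    · refine Or.inr ⟨q z, hzi ▸ hc z hz, ?_⟩
      refine (dist_pi_le_iff (by positivity)).2 fun j => ?_
      have : |(z j : ℝ) - x j| ≤ Fintype.card I := by exact_mod_cast hzx j
      rw [dist_comm, Real.dist_eq]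
      simp only [q]
      rw [← sub_mul, abs_mul, abs_of_pos (show 0 < 1 / ((n : ℝ) + 1) by positivity)]
      exact mul_le_mul_of_nonneg_right this (by positivity)
  choose x hx hnear using happrox
  obtain ⟨a, ha, φ, hφ, hlim⟩ := (isCompact_stdSimplex ℝ I).tendsto_subseq hx
  refine ⟨a, ha, fun i => ?_⟩
  have hsmall : Filter.Tendsto (fun n => (Fintype.card I : ℝ) * (1 / ((φ n : ℝ) + 1)))
      Filter.atTop (nhds 0) := by
    have := (tendsto_one_div_add_atTop_nhds_zero_nat (𝕜 := ℝ)).const_mul (Fintype.card I : ℝ)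
    rw [mul_zero] at this
    exact this.comp hφ.tendsto_atTop
  by_cases hi : a i = 0
  · exact Or.inl hi
  right
  have hpos : 0 < a i := lt_of_le_of_ne (ha.1 i) (Ne.symm hi)
  rw [← (hA i).closure_eq, Metric.mem_closure_iff]
  intro ε hε
  have hxi : Filter.Tendsto (fun n => x (φ n) i) Filter.atTop (nhds (a i)) :=
    (tendsto_pi_nhds.1 hlim) i
  have h1 := hxi.eventually_const_lt (half_lt_self hpos)
  have h2 := hsmall.eventually_lt_const (half_pos hpos)
  have h3 := hsmall.eventually_lt_const (half_pos hε)
  have h4 := (Metric.tendsto_nhds.1 hlim) (ε / 2) (half_pos hε)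
  obtain ⟨n, h1, h2, h3, h4⟩ := (h1.and (h2.and (h3.and h4))).exists
  rcases hnear (φ n) i with h | ⟨z, hz, hzx⟩
  · linarith
  · refine ⟨z, hz, ?_⟩
    have h5 := dist_triangle a (x (φ n)) z
    have h6 := dist_comm a (x (φ n))
    simp only [Function.comp_apply] at h4
    linarith

/-! ### Nash equilibria and Nash incentives -/

section Game

variable {N : Type*} [Fintype N] [DecidableEq N] {S : N → Type*} [∀ i, Fintype (S i)]

theorem continuous_extend (v : (∀ j, S j) → ℝ) : Continuous (extend v) := by
  unfold extend
  fun_prop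

theorem continuous_extend_update (v : (∀ j, S j) → ℝ) (i : N) (t : S i → ℝ) :
    Continuous fun x : ∀ j, S j → ℝ => extend v (Function.update x i t) :=
  (continuous_extend v).comp (continuous_id.update i continuous_const)

variable [∀ i, DecidableEq (S i)]

/-- The multilinear extension is linear in the strategy of agent `i`. -/
theorem extend_update (v : (∀ j, S j) → ℝ) (x : ∀ j, S j → ℝ) (i : N) (t : S i → ℝ) :
    extend v (Function.update x i t) =
      ∑ a, t a * extend v (Function.update x i (unitVec a)) := by
  have hprod : ∀ (s : S i → ℝ) (k : ∀ j, S j), ∏ j, Function.update x i s j (k j) =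
      s (k i) * ∏ j ∈ Finset.univ.erase i, x j (k j) := by
    intro s k
    rw [← Finset.mul_prod_erase _ _ (Finset.mem_univ i), Function.update_self]
    congr 1
    exact Finset.prod_congr rfl fun j hj => by
      rw [Function.update_of_ne (Finset.ne_of_mem_erase hj)]
  simp only [extend, hprod, Finset.mul_sum]
  rw [Finset.sum_comm]
  refine Finset.sum_congr rfl fun k _ => ?_
  rw [Finset.sum_eq_single (k i)]
  · simp only [unitVec, Pi.single_eq_same]; ring
  · intro a _ ha
    simp [unitVec, Pi.single_eq_of_ne ha.symm]
  · simp

theorem extend_eq_sum (v : (∀ j, S j) → ℝ) (x : ∀ j, S j → ℝ) (i : N) :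
    extend v x = ∑ a, x i a * extend v (Function.update x i (unitVec a)) := by
  rw [← extend_update, Function.update_eq_self]

theorem unitVec_mem_stdSimplex {A : Type*} [Fintype A] [DecidableEq A] (a : A) :
    unitVec a ∈ stdSimplex ℝ A := by
  simpa [unitVec] using single_mem_stdSimplex ℝ a

theorem isNashEquilibrium_iff {u : N → (∀ j, S j) → ℝ} {x : ∀ j, S j → ℝ} :
    IsNashEquilibrium u x ↔ x ∈ mixedProfiles S ∧
      ∀ i a, extend (u i) (Function.update x i (unitVec a)) ≤ extend (u i) x := by
  refine and_congr_right fun hx => forall_congr' fun i => ?_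
  constructor
  · exact fun h a => h.2 ⟨unitVec a, unitVec_mem_stdSimplex a, rfl⟩
  · refine fun h => ⟨⟨x i, hx i, by simp only [Function.update_eq_self]⟩, ?_⟩
    rintro _ ⟨t, ht, rfl⟩
    simp only
    rw [extend_update]
    calc ∑ a, t a * extend (u i) (Function.update x i (unitVec a))
        ≤ ∑ a, t a * extend (u i) x :=
          Finset.sum_le_sum fun a _ => mul_le_mul_of_nonneg_left (h a) (ht.1 a)
      _ = extend (u i) x := by rw [← Finset.sum_mul, ht.2, one_mul]

theorem isNashEquilibrium_iff_nashIncentive_eq_zero {u : N → (∀ j, S j) → ℝ}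
    {x : ∀ j, S j → ℝ} :
    IsNashEquilibrium u x ↔ x ∈ mixedProfiles S ∧ ∀ i a, nashIncentive u x i a = 0 := by
  rw [isNashEquilibrium_iff]
  simp only [nashIncentive, max_eq_left_iff, sub_nonpos]

theorem nashIncentive_nonneg (u : N → (∀ j, S j) → ℝ) (x : ∀ j, S j → ℝ) (i : N) (a : S i) :
    0 ≤ nashIncentive u x i a := le_max_left _ _

theorem isIncentive_nashIncentive (u : N → (∀ j, S j) → ℝ) : IsIncentive (nashIncentive u) := by
  refine fun i => ⟨fun x a _ => nashIncentive_nonneg u x i a, fun x h => ?_⟩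
  have := Finset.sum_nonneg fun a (_ : a ∈ Finset.univ) => nashIncentive_nonneg u x i a
  linarith

theorem continuous_nashIncentive (u : N → (∀ j, S j) → ℝ) : Continuous (nashIncentive u) :=
  continuous_pi fun i => continuous_pi fun a => continuous_const.max
    ((continuous_extend_update (u i) i (unitVec a)).sub (continuous_extend (u i)))

/-- Some strategy in the support of `x i` does not do better than the average `u i x`. -/
theorem exists_pos_nashIncentive_eq_zero (u : N → (∀ j, S j) → ℝ) {x : ∀ j, S j → ℝ}
    (hx : x ∈ mixedProfiles S) (i : N) : ∃ a, 0 < x i a ∧ nashIncentive u x i a = 0 := by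
  by_contra! h
  have hlt : ∀ a, 0 < x i a →
      extend (u i) x < extend (u i) (Function.update x i (unitVec a)) := by
    intro a ha
    by_contra! h'
    exact h a ha (max_eq_left (sub_nonpos.2 h'))
  obtain ⟨a, -, ha⟩ : ∃ a ∈ Finset.univ, 0 < x i a := by
    by_contra! h'
    have := Finset.sum_nonpos h'
    rw [(hx i).2] at this
    linarith
  refine lt_irrefl (extend (u i) x) ?_
  calc extend (u i) x = ∑ a, x i a * extend (u i) x := by
        rw [← Finset.sum_mul, (hx i).2, one_mul]
    _ < ∑ a, x i a * extend (u i) (Function.update x i (unitVec a)) := by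
        refine Finset.sum_lt_sum (fun b _ => ?_)
          ⟨a, Finset.mem_univ a, mul_lt_mul_of_pos_left (hlt a ha) ha⟩
        rcases ((hx i).1 b).eq_or_lt with hb | hb
        · rw [← hb, zero_mul, zero_mul]
        · exact mul_le_mul_of_nonneg_left (hlt b hb).le hb.le
    _ = extend (u i) x := (extend_eq_sum (u i) x i).symm

end Game

/-! ### Dot products with quotient vectors -/

theorem mul_quotient_eq_coe {y p : ℝ} :
    (y : EReal) * quotient p y = ((if y = 0 then 0 else p : ℝ) : EReal) := by
  unfold quotient
  by_cases hy : y = 0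
  · simp [hy]
  by_cases hp : p = 0
  · simp [hp]
  · simp only [hp, hy, if_false]
    rw [← EReal.coe_mul, mul_div_cancel₀ _ hy]

/-- Against itself, a strategy only picks up the incentives on its support, and the value is
finite. -/
theorem dotQuotient_self {A : Type*} [Fintype A] (y p : A → ℝ) :
    dotQuotient y p y = ((∑ a, if y a = 0 then 0 else p a : ℝ) : EReal) := by
  simp only [dotQuotient, mul_quotient_eq_coe]
  exact (map_sum (⟨⟨((↑) : ℝ → EReal), EReal.coe_zero⟩, EReal.coe_add⟩ : ℝ →+ EReal) _ _).symm

theorem dotQuotient_unitVec {A : Type*} [Fintype A] [DecidableEq A] (a : A) (p y : A → ℝ) :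
    dotQuotient (unitVec a) p y = quotient (p a) (y a) := by
  unfold dotQuotient
  rw [Finset.sum_eq_single a]
  · simp [unitVec]
  · intro b _ hb
    simp [unitVec, Pi.single_eq_of_ne hb]
  · simp

theorem dotQuotient_zero {A : Type*} [Fintype A] (t p y : A → ℝ) (hp : ∀ a, p a = 0) :
    dotQuotient t p y = 0 := by
  simp [dotQuotient, quotient, hp]

/-- If `y` maximises `t · (p / y)` over the simplex, then `p a ≤ y a * ∑ b, p b` for all `a`:
test the maximum against the unit vectors. Where `y a = 0`, a positive `p a` would give the value
`⊤`, whereas `y` itself has a finite value. -/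
theorem le_mul_sum_of_isGreatest {A : Type*} [Fintype A] [DecidableEq A] {p y : A → ℝ}
    (hp : ∀ a, 0 ≤ p a) (hy : ∀ a, 0 ≤ y a)
    (h : IsGreatest ((fun t => dotQuotient t p y) '' stdSimplex ℝ A) (dotQuotient y p y)) (a : A) :
    p a ≤ y a * ∑ b, p b := by
  have ha : quotient (p a) (y a) ≤ ((∑ b, if y b = 0 then 0 else p b : ℝ) : EReal) := by
    rw [← dotQuotient_self, ← dotQuotient_unitVec]
    exact h.2 ⟨unitVec a, unitVec_mem_stdSimplex a, rfl⟩
  have hsum : (∑ b, if y b = 0 then 0 else p b) ≤ ∑ b, p b :=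
    Finset.sum_le_sum fun b _ => by split_ifs; exacts [hp b, le_rfl]
  unfold quotient at ha
  split_ifs at ha with h1 h2 h3
  · rw [h1]
    exact mul_nonneg (hy a) (Finset.sum_nonneg fun b _ => hp b)
  · exact absurd (top_le_iff.1 ha) (EReal.coe_ne_top _)
  · exact absurd (lt_of_le_of_ne (hp a) (Ne.symm h1)) h3
  · have h4 := (EReal.coe_le_coe_iff.1 ha).trans hsum
    have h5 : 0 < y a := lt_of_le_of_ne (hy a) (Ne.symm h2)
    rw [div_le_iff₀ h5] at h4
    linarith

section Game

variable {N : Type*} [Fintype N] [DecidableEq N] {S : N → Type*} [∀ i, Fintype (S i)]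
  [∀ i, DecidableEq (S i)]

/-! ### Incentive equilibria and Nash equilibria -/

/-- At an incentive equilibrium, the Nash incentives `φ` of an agent satisfy
`φ a ≤ x a * ∑ b, φ b` for every strategy `a`. Summing over all strategies but one in the support
with incentive `0` makes `∑ b, φ b` vanish. -/
theorem isIncentiveEquilibrium_nashIncentive_iff {u : N → (∀ j, S j) → ℝ}
    {x : ∀ j, S j → ℝ} :
    IsIncentiveEquilibrium (nashIncentive u) x ↔ IsNashEquilibrium u x := by
  rw [isNashEquilibrium_iff_nashIncentive_eq_zero]
  refine and_congr_right fun hx => forall_congr' fun i => ?_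
  constructor
  · intro h
    have hp := nashIncentive_nonneg u x i
    have hle := le_mul_sum_of_isGreatest hp (hx i).1 h
    obtain ⟨a, ha, ha0⟩ := exists_pos_nashIncentive_eq_zero u hx i
    have hsum : ∑ b, nashIncentive u x i b ≤
        (1 - x i a) * ∑ b, nashIncentive u x i b := by
      rw [← Finset.add_sum_erase _ _ (Finset.mem_univ a), ha0, zero_add]
      calc ∑ b ∈ Finset.univ.erase a, nashIncentive u x i b
          ≤ ∑ b ∈ Finset.univ.erase a, x i b * ∑ b, nashIncentive u x i b :=
            Finset.sum_le_sum fun b _ => hle b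
        _ = (1 - x i a) * ∑ b ∈ Finset.univ.erase a, nashIncentive u x i b := by
            rw [← Finset.sum_mul, ← (hx i).2,
              ← Finset.add_sum_erase _ (x i) (Finset.mem_univ a),
              ← Finset.add_sum_erase _ (nashIncentive u x i) (Finset.mem_univ a), ha0, zero_add,
              add_sub_cancel_left]
    have h0 : ∑ b, nashIncentive u x i b = 0 :=
      le_antisymm (by nlinarith) (Finset.sum_nonneg fun b _ => hp b)
    exact fun b => (Finset.sum_eq_zero_iff_of_nonneg fun b _ => hp b).1 h0 b (Finset.mem_univ b)
  · intro h
    refine ⟨⟨x i, hx i, rfl⟩, ?_⟩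
    rintro _ ⟨t, -, rfl⟩
    simp only [dotQuotient_zero _ _ _ h, le_refl]

/-- The covering theorem is applied to the simplex on the set of all pairs `(i, a)`, where
`A (i, a)` is the set of the points `y` at which agent `i` has weight at most `1 / |N|` and `a` is a
best reply to the (rescaled) point `|N| • y`. At the point obtained, all weights are equal, and
only best replies are used. -/
theorem exists_isNashEquilibrium [∀ i, Nonempty (S i)] (u : N → (∀ j, S j) → ℝ) :
    ∃ x, IsNashEquilibrium u x := by
  rcases isEmpty_or_nonempty N with hN | hN
  · exact ⟨fun i => hN.elim i, fun i => hN.elim i, fun i => hN.elim i⟩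
  let m : ℝ := Fintype.card N
  have hm : 0 < m := Nat.cast_pos.2 Fintype.card_pos
  let X : ((Σ i, S i) → ℝ) → ∀ i, S i → ℝ := fun y i a => m * y ⟨i, a⟩
  have hX : Continuous X := by fun_prop
  let U : ∀ i, S i → ((Σ i, S i) → ℝ) → ℝ := fun i a y =>
    extend (u i) (Function.update (X y) i (unitVec a))
  have hU : ∀ i a, Continuous (U i a) := fun i a =>
    (continuous_extend_update (u i) i (unitVec a)).comp hX
  let A : (Σ i, S i) → Set ((Σ i, S i) → ℝ) := fun p =>
    {y | ∑ a, X y p.1 a ≤ 1} ∩ ⋂ b, {y | U p.1 b y ≤ U p.1 p.2 y}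
  have hA : ∀ p, IsClosed (A p) := by
    intro p
    refine (isClosed_le ?_ continuous_const).inter
      (isClosed_iInter fun b => isClosed_le (hU _ _) (hU _ _))
    fun_prop
  have htotal : ∀ y ∈ stdSimplex ℝ (Σ i, S i), ∑ i, ∑ a, X y i a = ∑ i : N, (1 : ℝ) := by
    intro y hy
    simp only [X, ← Finset.mul_sum]
    rw [← Fintype.sum_sigma' (fun i a => y ⟨i, a⟩)]
    simp [hy.2, m]
  have hcov : ∀ y ∈ stdSimplex ℝ (Σ i, S i), ∃ p, y ∈ A p := by
    intro y hy
    obtain ⟨i, -, hi⟩ := Finset.exists_le_of_sum_le (Finset.univ_nonempty (α := N))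
      (htotal y hy).le
    obtain ⟨a, -, ha⟩ := Finset.exists_max_image Finset.univ (fun a => U i a y)
      (Finset.univ_nonempty (α := S i))
    exact ⟨⟨i, a⟩, hi, Set.mem_iInter.2 fun b => ha b (Finset.mem_univ b)⟩
  have : Nonempty (Σ i, S i) := hN.elim fun i => ⟨⟨i, Classical.arbitrary _⟩⟩
  obtain ⟨y, hy, hyA⟩ := exists_mem_stdSimplex_of_closed_cover hA hcov
  have hXnn : ∀ i a, 0 ≤ X y i a := fun i a => mul_nonneg hm.le (hy.1 _)
  have hle : ∀ i, ∑ a, X y i a ≤ 1 := by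
    intro i
    by_contra! h
    obtain ⟨a, -, ha⟩ := Finset.exists_ne_zero_of_sum_ne_zero (by linarith : ∑ a, X y i a ≠ 0)
    rcases hyA ⟨i, a⟩ with h0 | h1
    · exact ha (by simp only [X, h0, mul_zero])
    · exact absurd h1.1 (not_le.2 h)
  have hone : ∀ i, ∑ a, X y i a = 1 := fun i =>
    (Finset.sum_eq_sum_iff_of_le fun i _ => hle i).1 (htotal y hy) i (Finset.mem_univ i)
  refine ⟨X y, isNashEquilibrium_iff.2 ⟨fun i => ⟨hXnn i, hone i⟩, fun i b => ?_⟩⟩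
  rw [extend_eq_sum (u i) (X y) i]
  calc extend (u i) (Function.update (X y) i (unitVec b))
      = ∑ a, X y i a * U i b y := by rw [← Finset.sum_mul, hone, one_mul]
    _ ≤ ∑ a, X y i a * U i a y := by
        refine Finset.sum_le_sum fun a _ => ?_
        rcases hyA ⟨i, a⟩ with h0 | h1
        · simp only [X, h0, mul_zero, zero_mul, le_refl]
        · exact mul_le_mul_of_nonneg_left (Set.mem_iInter.1 h1.2 b) (hXnn i a)

end Game

end IncentiveGame

theorem mainTheorem3 {N : Type*} [Fintype N] [DecidableEq N] {S : N → Type*}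
    [∀ i, Fintype (S i)] [∀ i, DecidableEq (S i)] [∀ i, Nonempty (S i)]
    (u : N → (∀ j, S j) → ℝ) :
    IncentiveGame.IsIncentive (IncentiveGame.nashIncentive u) ∧
    Continuous (IncentiveGame.nashIncentive u) ∧
    {x | IncentiveGame.IsIncentiveEquilibrium (IncentiveGame.nashIncentive u) x} =
      {x | IncentiveGame.IsNashEquilibrium u x} ∧
    {x | IncentiveGame.IsNashEquilibrium u x}.Nonempty :=
  ⟨IncentiveGame.isIncentive_nashIncentive u, IncentiveGame.continuous_nashIncentive u,
    Set.ext fun _ => IncentiveGame.isIncentiveEquilibrium_nashIncentive_iff,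
    IncentiveGame.exists_isNashEquilibrium u⟩
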